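/- \textbf{Theorem (Market Failure Probability).} Let $(\Omega,\mathcal F,\mathbb P)$ be a probability space, $d\ge 0$ and $K\ge 2$ integers. Let $X=(X_t)_{t\ge 0}$ be an $\mathbb R^d$-valued stochastic process with right continuous paths having left limits, and let $Z_0,Z_1,\dots,Z_K$ be exponential random variables with parameter $1$ that are independent of each other and of the process $X$. For $i=0,1,\dots,K$ let $\alpha_i:\mathbb R^d\to(0,\infty)$ be a continuous function, and put, for $s\ge 0$, $$A_i(s)=\int_0^s\alpha_i(X_r)\,dr,\qquad f_i(s)=\alpha_i(X_s)\,e^{-A_i(s)},\qquad \eta_i=\inf\{s\ge 0: A_i(s)\ge Z_i\}.$$ Assume that $\lim_{s\to\infty}A_i(s)=\infty$ almost surely for every $i=0,1,\dots,K$. For $i=1,\dots,K$ let $\tau_i=\min(\eta_0,\eta_i)$. Let $P_K$ be the set of all permutations $j=(j_1,\dots,j_K)$ of $(1,\dots,K)$. Then for every $\varepsilon>0$, $$\mathbb P\bigl(|\tau_i-\tau_j|<\varepsilon\text{ for some }i,j\in\{1,\dots,K\},\ i\neq j\bigr)=1-\mathbb E\Biggl[\sum_{j\in P_K}\int_0^\infty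 f_{j_1}(x_1)\int_{x_1+\varepsilon}^\infty f_{j_2}(x_2)\cdots\int_{x_{K-2}+\varepsilon}^\infty f_{j_{K-1}}(x_{K-1})\,\exp\bigl[-A_{j_K}(x_{K-1}+\varepsilon)-A_0(x_{K-1}+\varepsilon)\bigr]\,dx_{K-1}\cdots dx_2\,dx_1\Biggr].$$ (For $K=2$ there is a single integral, over $x_1\in(0,\infty)$.) In particular the event on the left is measurable up to a $\mathbb P$-null set, and the random variable inside the expectation is integrable. -/

import Mathlib

open MeasureTheory ProbabilityTheory Filter Topology Set
open scoped NNReal ENNReal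

noncomputable section

namespace MarketFailure

/-- A path indexed by `[0, ∞)` is right continuous with left limits. -/
def IsCadlag {E : Type*} [TopologicalSpace E] (x : ℝ≥0 → E) : Prop :=
  ∀ t : ℝ≥0, ContinuousWithinAt x (Ici t) t ∧ ∃ l : E, Tendsto x (𝓝[<] t) (𝓝 l)

section
variable {E : Type*}

/-- Cumulative intensity `A(s) = ∫₀ˢ a(x_r) dr` along a path `x`, for `s ≥ 0`. -/
def cumIntensity (a : E → ℝ) (x : ℝ≥0 → E) (s : ℝ) : ℝ :=
  ∫ r in (0 : ℝ)..s, a (x r.toNNReal)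

/-- `f(s) = a(x_s) exp(-A(s))`, for `s ≥ 0`. -/
def defaultDensity (a : E → ℝ) (x : ℝ≥0 → E) (s : ℝ) : ℝ :=
  a (x s.toNNReal) * Real.exp (-cumIntensity a x s)

/-- First passage time `η = inf {s ≥ 0 : A(s) ≥ z}`. The set is nonempty, and the real infimum is
the usual one, for every path along which `A(s) → ∞` as `s → ∞`. -/
def eventTime (a : E → ℝ) (x : ℝ≥0 → E) (z : ℝ) : ℝ :=
  sInf {s : ℝ | 0 ≤ s ∧ z ≤ cumIntensity a x s}

/-- Default time `τ_i = min(η_0, η_i)` of bank `i`. Index `0` of `Fin (K + 1)` is the market-wide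
event, and bank `i : Fin K` has index `i.succ`. -/
def defaultTime {K : ℕ} (α : Fin (K + 1) → E → ℝ) (x : ℝ≥0 → E) (z : Fin (K + 1) → ℝ)
    (i : Fin K) : ℝ :=
  min (eventTime (α 0) x (z 0)) (eventTime (α i.succ) x (z i.succ))

end

/-- The iterated integral
`∫_{a}^∞ f₁(x₁) ∫_{x₁+ε}^∞ f₂(x₂) ⋯ ∫_{x_{n-1}+ε}^∞ f_n(x_n) G(x_n + ε) dx_n ⋯ dx₁`,
where the entry `k : Fin n` of the family is `f_{k+1}`. -/
def gapIntegral (ε : ℝ) (G : ℝ → ℝ) : (n : ℕ) → (Fin n → ℝ → ℝ) → ℝ → ℝ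
  | 0, _, a => G a
  | n + 1, f, a => ∫ y in Ioi a, f 0 y * gapIntegral ε G n (fun k => f k.succ) (y + ε)

/-- The summand attached to the ordering `j = (σ(1), …, σ(K))` of the banks: the iterated integral
from `0` of `f_{j_1}, …, f_{j_{K-1}}` with terminal factor
`exp(-A_{j_K}(x_{K-1}+ε) - A_0(x_{K-1}+ε))`. -/
def orderTerm {E : Type*} {K : ℕ} (hK : 2 ≤ K) (ε : ℝ) (α : Fin (K + 1) → E → ℝ)
    (x : ℝ≥0 → E) (σ : Equiv.Perm (Fin K)) : ℝ :=
  gapIntegral ε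
    (fun s => Real.exp (-cumIntensity (α (σ ⟨K - 1, by omega⟩).succ) x s
      - cumIntensity (α 0) x s))
    (K - 1)
    (fun k : Fin (K - 1) => defaultDensity (α (σ (Fin.castLE (Nat.sub_le K 1) k)).succ) x)
    0

end MarketFailure

end

/-! Fix a path along which every `A_i` tends to infinity. Independent unit exponential thresholds
then give independent event times `η_i` with density `f_i` on `(0, ∞)` and survival function `exp
(-A_i)` (`map_eventTime`, `map_eventTime_Ici`).

The complement of market failure is that the `τ_i` are pairwise at least `ε` apart. It is the
disjoint union, over permutations, of the events that the `τ_i` increase by steps of at least `ε` in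
the given order (`separated_iff_exists_perm`, `perm_unique_of_gaps`). In such an order every bank
but the last defaults strictly before a later `τ`, which is at most `η_0`; its `τ` is therefore its
own `η`, and `η_0` matters only for the last bank. So `η_{j_1}, …, η_{j_{K-1}}` have gaps at least
`ε`, while `η_{j_K}` and `η_0` both come at least `ε` after `η_{j_{K-1}}` (`mem_gapSet_iff`).
Tonelli, one coordinate at a time, gives the iterated integral (`pi_gapSet`).

Averaging over the path uses independence of thresholds and process, and needs an event jointly
measurable in both. For this the intensities are rebuilt from path values on countable grids and the
passage times from rational times; the results agree with the originals on admissible paths, hence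
almost surely. -/

namespace MarketFailure

/-! ### Measurability and local boundedness of càdlàg paths -/

/-- The first point of the grid `(n + 1)⁻¹ ℕ` strictly to the right of `r`. -/
noncomputable def rightGrid (n : ℕ) (r : ℝ≥0) : ℝ≥0 := (⌊(n + 1) * r⌋₊ + 1) / (n + 1)

lemma le_rightGrid (n : ℕ) (r : ℝ≥0) : r ≤ rightGrid n r := by
  rw [rightGrid, le_div_iff₀ (by positivity), mul_comm]
  exact (Nat.lt_floor_add_one _).le

lemma rightGrid_le (n : ℕ) (r : ℝ≥0) : rightGrid n r ≤ r + 1 / (n + 1) := by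
  rw [rightGrid, add_div]
  gcongr
  rw [div_le_iff₀ (by positivity), mul_comm]
  exact Nat.floor_le (by positivity)

lemma tendsto_rightGrid (r : ℝ≥0) : Tendsto (fun n => rightGrid n r) atTop (𝓝[≥] r) := by
  refine tendsto_nhdsWithin_iff.2 ⟨?_, Eventually.of_forall fun n => le_rightGrid n r⟩
  refine tendsto_of_tendsto_of_tendsto_of_le_of_le tendsto_const_nhds ?_
    (fun n => le_rightGrid n r) (fun n => rightGrid_le n r)
  have h : Tendsto (fun n : ℕ => r + 1 / ((n : ℝ≥0) + 1)) atTop (𝓝 (r + 0)) :=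
    tendsto_const_nhds.add tendsto_one_div_add_atTop_nhds_zero_nat
  simpa using h

lemma measurable_comp_rightGrid (y : ℝ≥0 → ℝ) (n : ℕ) :
    Measurable fun r => y (rightGrid n r) := by
  have h : Measurable fun k : ℕ => y ((k + 1) / (n + 1)) := measurable_from_nat
  exact h.comp (Nat.measurable_floor.comp (measurable_id.const_mul _))

lemma measurable_of_rightContinuous {y : ℝ≥0 → ℝ}
    (hy : ∀ t, ContinuousWithinAt y (Ici t) t) : Measurable y :=
  measurable_of_tendsto_metrizable (fun n => measurable_comp_rightGrid y n)
    (tendsto_pi_nhds.2 fun t => (hy t).tendsto.comp (tendsto_rightGrid t))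

lemma IsCadlag.continuous_comp {E F : Type*} [TopologicalSpace E] [TopologicalSpace F]
    {x : ℝ≥0 → E} (hx : IsCadlag x) {a : E → F} (ha : Continuous a) : IsCadlag (a ∘ x) :=
  fun t => ⟨ha.continuousAt.comp_continuousWithinAt (hx t).1,
    let ⟨l, hl⟩ := (hx t).2; ⟨a l, (ha.tendsto l).comp hl⟩⟩

/-- The left limit bounds `y` just before each point and right continuity bounds it from there on;
compactness makes the bound uniform. -/
lemma IsCadlag.exists_bound {y : ℝ≥0 → ℝ} (hy : IsCadlag y) (T : ℝ≥0) :
    ∃ M, ∀ t ≤ T, |y t| ≤ M := by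
  have key : ∃ M, ∀ t ∈ Icc 0 T, |y t| ≤ M := by
    refine isCompact_Icc.induction_on (p := fun s => ∃ M, ∀ t ∈ s, |y t| ≤ M) ⟨0, by simp⟩
      (fun s t hst ⟨M, hM⟩ => ⟨M, fun r hr => hM r (hst hr)⟩) ?_ fun t _ => ?_
    · rintro s t ⟨M, hM⟩ ⟨N, hN⟩
      exact ⟨max M N, fun r hr => hr.elim (fun h => (hM r h).trans (le_max_left _ _))
        fun h => (hN r h).trans (le_max_right _ _)⟩
    · obtain ⟨hr, l, hl⟩ := hy t
      have h1 : ∀ᶠ s in 𝓝[<] t, |y s| ≤ max (|l| + 1) (|y t| + 1) :=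
        (hl.abs.eventually_le_const (lt_add_one _)).mono fun s hs => hs.trans (le_max_left _ _)
      have h2 : ∀ᶠ s in 𝓝[≥] t, |y s| ≤ max (|l| + 1) (|y t| + 1) :=
        (hr.tendsto.abs.eventually_le_const (lt_add_one _)).mono
          fun s hs => hs.trans (le_max_right _ _)
      have h3 : ∀ᶠ s in 𝓝 t, |y s| ≤ max (|l| + 1) (|y t| + 1) := by
        rw [← nhdsLT_sup_nhdsGE]
        exact eventually_sup.2 ⟨h1, h2⟩
      exact ⟨{s | |y s| ≤ max (|l| + 1) (|y t| + 1)}, mem_nhdsWithin_of_mem_nhds h3,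
        _, fun s hs => hs⟩
  obtain ⟨M, hM⟩ := key
  exact ⟨M, fun t ht => hM t ⟨zero_le, ht⟩⟩

lemma abs_toNNReal_bound {y : ℝ≥0 → ℝ} (hy : IsCadlag y) (b : ℝ) :
    ∃ M, ∀ r ≤ b, |y r.toNNReal| ≤ M :=
  let ⟨M, hM⟩ := hy.exists_bound b.toNNReal
  ⟨M, fun _ hr => hM _ (Real.toNNReal_le_toNNReal hr)⟩

lemma IsCadlag.measurable {y : ℝ≥0 → ℝ} (hy : IsCadlag y) : Measurable y :=
  measurable_of_rightContinuous fun t => (hy t).1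

lemma IsCadlag.intervalIntegrable {y : ℝ≥0 → ℝ} (hy : IsCadlag y) (a b : ℝ) :
    IntervalIntegrable (fun r : ℝ => y r.toNNReal) volume a b := by
  obtain ⟨M, hM⟩ := abs_toNNReal_bound hy (max a b)
  rw [intervalIntegrable_iff]
  refine Measure.integrableOn_of_bounded (M := M) (by simp [uIoc])
    (hy.measurable.comp measurable_real_toNNReal).aestronglyMeasurable ?_
  exact (ae_restrict_iff' measurableSet_uIoc).2
    (Eventually.of_forall fun r hr => hM r (by simpa using hr.2))

/-! ### Law of one event time along a fixed path -/

variable {E : Type*}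

/-- The properties of an intensity `a` along a path `x` on which the law of the event time
depends. -/
structure IsAdmissible (a : E → ℝ) (x : ℝ≥0 → E) : Prop where
  pos : ∀ t, 0 < a (x t)
  cadlag : IsCadlag (a ∘ x)
  tendsto : Tendsto (fun s => cumIntensity a x s) atTop atTop

namespace IsAdmissible
variable {a : E → ℝ} {x : ℝ≥0 → E}

lemma measurable_comp (h : IsAdmissible a x) : Measurable fun r : ℝ => a (x r.toNNReal) :=
  h.cadlag.measurable.comp measurable_real_toNNReal

lemma continuous_cumIntensity (h : IsAdmissible a x) : Continuous (cumIntensity a x) :=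
  intervalIntegral.continuous_primitive (fun c d => h.cadlag.intervalIntegrable c d) 0

lemma strictMono_cumIntensity (h : IsAdmissible a x) : StrictMono (cumIntensity a x) := by
  intro s t hst
  have hi := fun c d => h.cadlag.intervalIntegrable c d
  have h1 := intervalIntegral.integral_add_adjacent_intervals (hi 0 s) (hi s t)
  have h2 : 0 < ∫ r in s..t, (a ∘ x) r.toNNReal :=
    intervalIntegral.intervalIntegral_pos_of_pos (hi s t) (fun r => h.pos _) hst
  simp only [Function.comp_apply] at h1 h2
  unfold cumIntensity
  linarith

/-- Since `a ∘ x` is only right continuous, only a right derivative is available; with continuity of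
`A` this suffices for the fundamental theorem of calculus. -/
lemma hasDerivWithinAt_cumIntensity (h : IsAdmissible a x) (t : ℝ) :
    HasDerivWithinAt (cumIntensity a x) (a (x t.toNNReal)) (Ioi t) t := by
  have hc : ContinuousWithinAt (fun r : ℝ => a (x r.toNNReal)) (Ioi t) t := by
    have h1 := (h.cadlag t.toNNReal).1
    have h2 : ContinuousWithinAt (fun r : ℝ => (a ∘ x) r.toNNReal) (Ici t) t :=
      h1.comp continuous_real_toNNReal.continuousWithinAt
        fun r hr => Real.toNNReal_le_toNNReal hr
    exact h2.mono Ioi_subset_Ici_self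
  exact (intervalIntegral.integral_hasDerivWithinAt_right (s := Ici t)
    (h.cadlag.intervalIntegrable 0 t)
    h.measurable_comp.stronglyMeasurable.stronglyMeasurableAtFilter hc).mono Ioi_subset_Ici_self

lemma defaultDensity_pos (h : IsAdmissible a x) (s : ℝ) : 0 < defaultDensity a x s :=
  mul_pos (h.pos _) (Real.exp_pos _)

lemma measurable_defaultDensity (h : IsAdmissible a x) : Measurable (defaultDensity a x) :=
  h.measurable_comp.mul (Real.measurable_exp.comp h.continuous_cumIntensity.measurable.neg)

lemma cumIntensity_zero (a : E → ℝ) (x : ℝ≥0 → E) : cumIntensity a x 0 = 0 := by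
  simp [cumIntensity]

lemma cumIntensity_nonneg (h : IsAdmissible a x) {t : ℝ} (ht : 0 ≤ t) : 0 ≤ cumIntensity a x t := by
  rw [← cumIntensity_zero a x]
  exact h.strictMono_cumIntensity.monotone ht

lemma setLIntegral_defaultDensity (h : IsAdmissible a x) {t : ℝ} (ht : 0 ≤ t) :
    ∫⁻ s in Ioc 0 t, ENNReal.ofReal (defaultDensity a x s)
      = ENNReal.ofReal (1 - Real.exp (-cumIntensity a x t)) := by
  have hint : IntervalIntegrable (defaultDensity a x) volume 0 t :=
    (h.cadlag.intervalIntegrable 0 t).mul_continuousOn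
      (Real.continuous_exp.comp h.continuous_cumIntensity.neg).continuousOn
  have h1 : ∫ s in (0 : ℝ)..t, defaultDensity a x s
      = -Real.exp (-cumIntensity a x t) - -Real.exp (-cumIntensity a x 0) := by
    refine intervalIntegral.integral_eq_sub_of_hasDeriv_right
      (f := fun s => -Real.exp (-cumIntensity a x s))
      (Real.continuous_exp.comp h.continuous_cumIntensity.neg).neg.continuousOn (fun s _ => ?_) hint
    have := (h.hasDerivWithinAt_cumIntensity s).neg.exp.neg
    rwa [mul_neg, neg_neg, mul_comm] at this
  rw [cumIntensity_zero, intervalIntegral.integral_of_le ht] at h1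
  rw [← ofReal_integral_eq_lintegral_ofReal
    ((intervalIntegrable_iff_integrableOn_Ioc_of_le ht).1 hint)
    (Eventually.of_forall fun s => (h.defaultDensity_pos s).le), h1]
  congr 1
  simp
  ring

lemma nonempty_passage (h : IsAdmissible a x) (z : ℝ) : {s : ℝ | 0 ≤ s ∧ z ≤ cumIntensity a x s}.Nonempty := by
  obtain ⟨s, hs⟩ := ((h.tendsto.eventually_ge_atTop z).and (eventually_ge_atTop 0)).exists
  exact ⟨s, hs.2, hs.1⟩

lemma bddBelow_passage (a : E → ℝ) (x : ℝ≥0 → E) (z : ℝ) :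
    BddBelow {s : ℝ | 0 ≤ s ∧ z ≤ cumIntensity a x s} :=
  ⟨0, fun _ hs => hs.1⟩

lemma eventTime_nonneg (a : E → ℝ) (x : ℝ≥0 → E) (z : ℝ) : 0 ≤ eventTime a x z :=
  Real.sInf_nonneg fun _ hs => hs.1

lemma le_cumIntensity_eventTime (h : IsAdmissible a x) (z : ℝ) : z ≤ cumIntensity a x (eventTime a x z) := by
  have hc : IsClosed {s : ℝ | 0 ≤ s ∧ z ≤ cumIntensity a x s} :=
    isClosed_Ici.inter (isClosed_Ici.preimage h.continuous_cumIntensity)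
  exact (hc.csInf_mem (h.nonempty_passage z) (bddBelow_passage a x z)).2

/-- Continuity of `A` makes the infimum attained. The equivalence carries the exponential
distribution function over to the event time. -/
lemma eventTime_le_iff (h : IsAdmissible a x) {z t : ℝ} (ht : 0 ≤ t) :
    eventTime a x z ≤ t ↔ z ≤ cumIntensity a x t :=
  ⟨fun hz => (h.le_cumIntensity_eventTime z).trans (h.strictMono_cumIntensity.monotone hz),
    fun hz => csInf_le (bddBelow_passage a x z) ⟨ht, hz⟩⟩

lemma measurable_eventTime (h : IsAdmissible a x) : Measurable (eventTime a x) := by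
  refine measurable_of_Iic fun t => ?_
  rcases lt_or_ge t 0 with ht | ht
  · convert MeasurableSet.empty using 1
    ext z
    simpa using ht.trans_le (eventTime_nonneg a x z)
  · convert measurableSet_Iic (a := cumIntensity a x t) using 1
    ext z
    exact h.eventTime_le_iff ht

/-- With a unit exponential threshold, the event time has density `f` on `(0, ∞)`. -/
lemma map_eventTime (h : IsAdmissible a x) : (expMeasure 1).map (eventTime a x)
    = (volume.restrict (Ioi 0)).withDensity fun s => ENNReal.ofReal (defaultDensity a x s) := by
  have := isProbabilityMeasure_expMeasure (r := 1) one_pos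
  have := Measure.isProbabilityMeasure_map (μ := expMeasure 1) h.measurable_eventTime.aemeasurable
  refine Measure.ext_of_Iic _ _ fun t => ?_
  rw [Measure.map_apply h.measurable_eventTime measurableSet_Iic,
    withDensity_apply _ measurableSet_Iic, Measure.restrict_restrict measurableSet_Iic,
    inter_comm, Ioi_inter_Iic]
  rcases lt_or_ge t 0 with ht | ht
  · rw [Ioc_eq_empty (by linarith)]
    convert measure_empty (μ := expMeasure 1) using 2
    · ext z
      simpa using ht.trans_le (eventTime_nonneg a x z)
    · simp
  · rw [h.setLIntegral_defaultDensity ht]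
    have h1 : eventTime a x ⁻¹' Iic t = Iic (cumIntensity a x t) := by
      ext z
      exact h.eventTime_le_iff ht
    have h2 := cdf_expMeasure_eq (r := 1) one_pos (cumIntensity a x t)
    rw [if_pos (h.cumIntensity_nonneg ht), one_mul, cdf_eq_real] at h2
    rw [h1, ← h2, ofReal_measureReal]

lemma map_eventTime_Ici (h : IsAdmissible a x) {t : ℝ} (ht : 0 ≤ t) :
    ((expMeasure 1).map (eventTime a x)) (Ici t)
      = ENNReal.ofReal (Real.exp (-cumIntensity a x t)) := by
  have := isProbabilityMeasure_expMeasure (r := 1) one_pos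
  have := Measure.isProbabilityMeasure_map (μ := expMeasure 1) h.measurable_eventTime.aemeasurable
  -- A law with a density has no atoms, so `Ici t` has the mass of `Ioi t`, the complement of `Iic
  -- t`.
  have h0 : NullSingletonClass ((expMeasure 1).map (eventTime a x)) := by
    rw [h.map_eventTime]
    infer_instance
  have h1 : ((expMeasure 1).map (eventTime a x)) (Iic t)
      = ENNReal.ofReal (1 - Real.exp (-cumIntensity a x t)) := by
    rw [h.map_eventTime, withDensity_apply _ measurableSet_Iic,
      Measure.restrict_restrict measurableSet_Iic, inter_comm, Ioi_inter_Iic,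
      h.setLIntegral_defaultDensity ht]
  have h2 : Real.exp (-cumIntensity a x t) ≤ 1 :=
    Real.exp_le_one_iff.2 (neg_nonpos.2 (h.cumIntensity_nonneg ht))
  rw [← measure_congr Ioi_ae_eq_Ici, ← compl_Iic, prob_compl_eq_one_sub measurableSet_Iic, h1,
    ← ENNReal.ofReal_one, ← ENNReal.ofReal_sub _ (by linarith)]
  congr 1
  ring

end IsAdmissible

/-! ### Gap sets and the iterated integral -/

/-- Times `t 0, …, t n, t (n + 1)` such that `t 0 ≥ a`, each of `t 1, …, t n` exceeds its predecessor
by at least `ε`, and so does `t (n + 1)` with respect to `t (n - 1)`. -/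
def gapSet (ε : ℝ) : (n : ℕ) → ℝ → Set (Fin (n + 2) → ℝ)
  | 0, a => {t | a ≤ t 0 ∧ a ≤ t 1}
  | n + 1, a => {t | a ≤ t 0 ∧ (fun k : Fin (n + 2) => t k.succ) ∈ gapSet ε n (t 0 + ε)}

lemma measurableSet_gapSet_prod (ε : ℝ) (n : ℕ) :
    MeasurableSet {p : ℝ × (Fin (n + 2) → ℝ) | p.2 ∈ gapSet ε n p.1} := by
  induction n with
  | zero =>
    exact (measurableSet_le measurable_fst (by fun_prop)).inter
      (measurableSet_le measurable_fst (by fun_prop))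
  | succ n ih =>
    have h : Measurable fun p : ℝ × (Fin (n + 3) → ℝ) =>
        (p.2 0 + ε, fun k : Fin (n + 2) => p.2 k.succ) := by fun_prop
    exact (measurableSet_le measurable_fst (by fun_prop)).inter (h ih)

lemma measurableSet_gapSet (ε : ℝ) (n : ℕ) (a : ℝ) : MeasurableSet (gapSet ε n a) :=
  measurable_prodMk_left (measurableSet_gapSet_prod ε n)

lemma antitone_gapSet (ε : ℝ) (n : ℕ) : Antitone (gapSet ε n) := by
  intro a b hab t ht
  cases n with
  | zero => exact ⟨hab.trans ht.1, hab.trans ht.2⟩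
  | succ n => exact ⟨hab.trans ht.1, ht.2⟩

/-- The last coordinate plays the role of `η_0`. Were `t 0` at least that coordinate, the first
minimum would equal it, and the next minimum could not exceed it by `ε > 0`. -/
lemma mem_gapSet_iff {ε : ℝ} (hε : 0 < ε) (n : ℕ) (a : ℝ) (t : Fin (n + 2) → ℝ) :
    t ∈ gapSet ε n a ↔
      a ≤ min (t 0) (t (Fin.last (n + 1))) ∧
      ∀ k : Fin n, min (t k.castSucc.castSucc) (t (Fin.last (n + 1))) + ε
        ≤ min (t k.succ.castSucc) (t (Fin.last (n + 1))) := by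
  induction n generalizing a with
  | zero =>
    simp only [IsEmpty.forall_iff, and_true, le_min_iff]
    rfl
  | succ n ih =>
    have h : t ∈ gapSet ε (n + 1) a ↔
      a ≤ t 0 ∧ (fun k : Fin (n + 2) => t k.succ) ∈ gapSet ε n (t 0 + ε) := Iff.rfl
    rw [h, ih, Fin.forall_fin_succ]
    simp only [Fin.succ_last, Fin.castSucc_zero, ← Fin.succ_castSucc]
    generalize (∀ i : Fin n, _) = P
    rw [← and_assoc, ← and_assoc]
    refine and_congr_left fun _ => ⟨fun ⟨h1, h2⟩ => ?_, fun ⟨h1, h2⟩ => ?_⟩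
    · have h3 := le_min_iff.1 h2
      rw [min_eq_left (a := t 0) (by linarith)]
      exact ⟨h1, h2⟩
    · rcases le_total (t 0) (t (Fin.last (n + 2))) with h3 | h3
      · rw [min_eq_left h3] at h1 h2
        exact ⟨h1, h2⟩
      · rw [min_eq_right h3] at h2
        have := h2.trans (min_le_right _ _)
        linarith

lemma pi_gapSet_succ {ε : ℝ} {n : ℕ} (ν : Fin (n + 3) → Measure ℝ)
    [∀ k, IsProbabilityMeasure (ν k)] (a : ℝ) :
    Measure.pi ν (gapSet ε (n + 1) a)
      = ∫⁻ y in Ici a, Measure.pi (fun k : Fin (n + 2) => ν k.succ) (gapSet ε n (y + ε)) ∂ν 0 := by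
  have hm : MeasurableSet
      {p : ℝ × (Fin (n + 2) → ℝ) | p.1 ∈ Ici a ∧ p.2 ∈ gapSet ε n (p.1 + ε)} := by
    have h : Measurable fun p : ℝ × (Fin (n + 2) → ℝ) => (p.1 + ε, p.2) := by fun_prop
    exact (measurable_fst measurableSet_Ici).inter (h (measurableSet_gapSet_prod ε n))
  have h := (measurePreserving_piFinSuccAbove ν 0).measure_preimage hm.nullMeasurableSet
  have h1 : (MeasurableEquiv.piFinSuccAbove (fun _ => ℝ) (0 : Fin (n + 3))) ⁻¹'
      {p : ℝ × (Fin (n + 2) → ℝ) | p.1 ∈ Ici a ∧ p.2 ∈ gapSet ε n (p.1 + ε)}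
      = gapSet ε (n + 1) a := rfl
  rw [h1, Measure.prod_apply hm] at h
  rw [h, ← lintegral_indicator measurableSet_Ici]
  refine lintegral_congr fun y => ?_
  by_cases hy : y ∈ Ici a
  · rw [indicator_of_mem hy]
    congr 1
    ext t
    simp [show a ≤ y from hy]
  · rw [indicator_of_notMem hy]
    refine measure_mono_null (fun t ht => ?_) measure_empty
    exact absurd ht.1 hy

/-- Nonnegativity is part of the induction because it lets the Bochner integrals in `gapIntegral` be
read as Lebesgue integrals. -/
lemma pi_gapSet {ε : ℝ} (hε : 0 < ε) (G : ℝ → ℝ) (n : ℕ) (ν : Fin (n + 2) → Measure ℝ)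
    [∀ k, IsProbabilityMeasure (ν k)] (f : Fin n → ℝ → ℝ) (hf : ∀ k, Measurable (f k))
    (hf0 : ∀ k s, 0 ≤ f k s)
    (hν : ∀ k, ν (Fin.castSucc (Fin.castSucc k))
      = (volume.restrict (Ioi 0)).withDensity fun s => ENNReal.ofReal (f k s))
    (hG : ∀ s, 0 ≤ G s)
    (hνG : ∀ s, 0 ≤ s → ν (Fin.castSucc (Fin.last n)) (Ici s) * ν (Fin.last (n + 1)) (Ici s)
      = ENNReal.ofReal (G s)) {a : ℝ} (ha : 0 ≤ a) :
    0 ≤ gapIntegral ε G n f a ∧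
      Measure.pi ν (gapSet ε n a) = ENNReal.ofReal (gapIntegral ε G n f a) := by
  induction n generalizing a with
  | zero =>
    have h : gapSet ε 0 a = univ.pi fun _ => Ici a := by
      ext t
      rw [mem_univ_pi]
      exact (Fin.forall_fin_two (p := fun i => a ≤ t i)).symm
    rw [h, Measure.pi_pi, Fin.prod_univ_two]
    exact ⟨hG a, hνG a ha⟩
  | succ n ih =>
    have hν0 : ν 0 = (volume.restrict (Ioi 0)).withDensity fun s => ENNReal.ofReal (f 0 s) :=
      hν 0
    have key := fun y (hy : y ∈ Ioi a) => ih (fun k => ν k.succ) (fun k => f k.succ)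
      (fun k => hf _) (fun k => hf0 _) (fun k => hν k.succ) hνG
      (a := y + ε) (by have : a < y := hy; linarith)
    set g : ℝ → ℝ := fun y => gapIntegral ε G n (fun k => f k.succ) (y + ε)
    have hmeas : Measurable fun y =>
        Measure.pi (fun k : Fin (n + 2) => ν k.succ) (gapSet ε n (y + ε)) :=
      Antitone.measurable fun y y' hy => measure_mono (antitone_gapSet ε n (by linarith))
    have h1 : Measure.pi ν (gapSet ε (n + 1) a)
        = ∫⁻ y in Ioi a, ENNReal.ofReal (f 0 y * g y) := by
      rw [pi_gapSet_succ, hν0, setLIntegral_withDensity_eq_setLIntegral_mul _ (hf 0).ennreal_ofReal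
        hmeas measurableSet_Ici, Measure.restrict_restrict measurableSet_Ici,
        setLIntegral_congr ((Ioi_ae_eq_Ici (a := a)).symm.inter (ae_eq_refl (Ioi 0))),
        Ioi_inter_Ioi, sup_eq_left.2 ha]
      refine setLIntegral_congr_fun measurableSet_Ioi fun y hy => ?_
      rw [Pi.mul_apply, (key y hy).2, ENNReal.ofReal_mul (hf0 0 y)]
    have h0 : ∀ᵐ y ∂volume.restrict (Ioi a), 0 ≤ f 0 y * g y :=
      (ae_restrict_iff' measurableSet_Ioi).2
        (Eventually.of_forall fun y hy => mul_nonneg (hf0 0 y) (key y hy).1)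
    have hsm : AEStronglyMeasurable (fun y => f 0 y * g y) (volume.restrict (Ioi a)) := by
      refine ((hf 0).mul hmeas.ennreal_toReal).aestronglyMeasurable.congr ?_
      refine (ae_restrict_iff' measurableSet_Ioi).2 (Eventually.of_forall fun y hy => ?_)
      rw [Pi.mul_apply, (key y hy).2, ENNReal.toReal_ofReal (key y hy).1]
    refine ⟨integral_nonneg_of_ae h0, ?_⟩
    rw [show gapIntegral ε G (n + 1) f a = ∫ y in Ioi a, f 0 y * g y from rfl,
      integral_eq_lintegral_of_nonneg_ae h0 hsm, ← h1, ENNReal.ofReal_toReal (measure_ne_top _ _)]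

/-! ### Orderings of the banks and the conditional separation probability -/

/-- The identification of positions `0, …, n` with the banks in the order `σ`, the last position
being the market-wide event. -/
def positionEquiv {n : ℕ} (σ : Equiv.Perm (Fin (n + 1))) : Equiv.Perm (Fin (n + 2)) :=
  (finRotate (n + 2)).trans (Equiv.Perm.decomposeFin.symm (0, σ))

lemma positionEquiv_castSucc {n : ℕ} (σ : Equiv.Perm (Fin (n + 1))) (k : Fin (n + 1)) :
    positionEquiv σ k.castSucc = (σ k).succ := by
  simp [positionEquiv]

lemma positionEquiv_last {n : ℕ} (σ : Equiv.Perm (Fin (n + 1))) :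
    positionEquiv σ (Fin.last (n + 1)) = 0 := by
  simp [positionEquiv]

lemma pi_reindex {ι : Type*} [Fintype ι] (ν : ι → Measure ℝ)
    [∀ k, IsProbabilityMeasure (ν k)] (e : Equiv.Perm ι) {s : Set (ι → ℝ)} (hs : MeasurableSet s) :
    Measure.pi ν {t | (fun k => t (e k)) ∈ s} = Measure.pi (fun k => ν (e k)) s := by
  have h := measurePreserving_piCongrLeft ν e
  have hm : MeasurableSet {t : ι → ℝ | (fun k => t (e k)) ∈ s} :=
    (measurable_pi_lambda _ fun k => measurable_pi_apply (e k)) hs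
  rw [← h.measure_preimage hm.nullMeasurableSet]
  congr 1
  ext t
  have : (fun k => (MeasurableEquiv.piCongrLeft (fun _ => ℝ) e) t (e k)) = t :=
    funext fun k => Equiv.piCongrLeft_apply_apply (fun _ => ℝ) e t k
  simp [this]

/-- Pairwise distances of at least `ε` mean consecutive gaps of at least `ε` in increasing order. -/
lemma separated_iff_exists_perm {n : ℕ} {ε : ℝ} (hε : 0 < ε) (τ : Fin (n + 1) → ℝ) :
    (∀ i j, i ≠ j → ε ≤ |τ i - τ j|) ↔
      ∃ σ : Equiv.Perm (Fin (n + 1)), ∀ k : Fin n, τ (σ k.castSucc) + ε ≤ τ (σ k.succ) := by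
  constructor
  · refine fun h => ⟨Tuple.sort τ, fun k => ?_⟩
    have h1 := Tuple.monotone_sort τ (Fin.castSucc_lt_succ (i := k)).le
    have h2 := h (Tuple.sort τ k.castSucc) (Tuple.sort τ k.succ)
      fun he => (Fin.castSucc_lt_succ (i := k)).ne ((Tuple.sort τ).injective he)
    simp only [Function.comp_apply] at h1
    rw [abs_sub_comm, abs_of_nonneg (by linarith)] at h2
    linarith
  · rintro ⟨σ, h⟩
    have hmono : StrictMono (τ ∘ σ) :=
      Fin.strictMono_iff_lt_succ.2 fun k => by have := h k; simp only [Function.comp_apply]; linarith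
    have hlt : ∀ i j, i < j → τ (σ i) + ε ≤ τ (σ j) := by
      intro i j hij
      obtain ⟨k, rfl⟩ := Fin.exists_castSucc_eq.2 (Fin.ne_last_of_lt hij)
      exact (h k).trans (hmono.monotone (Fin.castSucc_lt_iff_succ_le.1 hij))
    intro i j hij
    obtain ⟨i, rfl⟩ := σ.surjective i
    obtain ⟨j, rfl⟩ := σ.surjective j
    rcases lt_trichotomy i j with h1 | h1 | h1
    · have := hlt i j h1
      rw [abs_sub_comm]
      exact le_trans (by linarith) (le_abs_self _)
    · exact absurd (congrArg σ h1) hij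
    · have := hlt j i h1
      exact le_trans (by linarith) (le_abs_self _)

/-- Positive gaps force the values of `τ` to be distinct, and an injective family has only one
increasing arrangement. -/
lemma perm_unique_of_gaps {n : ℕ} {ε : ℝ} (hε : 0 < ε) {τ : Fin (n + 1) → ℝ}
    {σ σ' : Equiv.Perm (Fin (n + 1))} (h : ∀ k : Fin n, τ (σ k.castSucc) + ε ≤ τ (σ k.succ))
    (h' : ∀ k : Fin n, τ (σ' k.castSucc) + ε ≤ τ (σ' k.succ)) : σ = σ' := by
  have hs : ∀ ρ : Equiv.Perm (Fin (n + 1)), (∀ k : Fin n, τ (ρ k.castSucc) + ε ≤ τ (ρ k.succ)) →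
      StrictMono (τ ∘ ρ) := fun ρ hρ => Fin.strictMono_iff_lt_succ.2
    fun k => by have := hρ k; simp only [Function.comp_apply]; linarith
  have h1 := Tuple.unique_monotone (hs σ h).monotone (hs σ' h').monotone
  have hinj : Function.Injective τ := by
    have := (hs σ h).injective.comp σ.symm.injective
    rwa [Function.comp_assoc, Equiv.self_comp_symm] at this
  exact Equiv.ext fun k => hinj (congrFun h1 k)

section
variable {E : Type*}

/-- Conditionally on the path, the probability that all default times are `ε`-separated. -/
lemma pi_exp_separated {n : ℕ} (hn : 2 ≤ n + 1) {ε : ℝ} (hε : 0 < ε)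
    (α : Fin (n + 2) → E → ℝ) (x : ℝ≥0 → E) (h : ∀ i, IsAdmissible (α i) x) :
    0 ≤ ∑ σ, orderTerm hn ε α x σ ∧
    Measure.pi (fun _ : Fin (n + 2) => expMeasure 1)
      {z | ∀ i j : Fin (n + 1), i ≠ j → ε ≤ |defaultTime α x z i - defaultTime α x z j|}
      = ENNReal.ofReal (∑ σ, orderTerm hn ε α x σ) := by
  have hexp := isProbabilityMeasure_expMeasure (r := 1) one_pos
  set ν : Fin (n + 2) → Measure ℝ := fun k => (expMeasure 1).map (eventTime (α k) x) with hν
  have hprob : ∀ k, IsProbabilityMeasure (ν k) := fun k =>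
    Measure.isProbabilityMeasure_map (h k).measurable_eventTime.aemeasurable
  set η : (Fin (n + 2) → ℝ) → Fin (n + 2) → ℝ := fun z k => eventTime (α k) x (z k) with hη
  have hηm : Measurable η := measurable_pi_lambda _ fun k =>
    (h k).measurable_eventTime.comp (measurable_pi_apply k)
  have hmap : (Measure.pi fun _ : Fin (n + 2) => expMeasure 1).map η = Measure.pi ν :=
    Measure.pi_map_pi fun k => (h k).measurable_eventTime.aemeasurable
  set D : Equiv.Perm (Fin (n + 1)) → Set (Fin (n + 2) → ℝ) :=
    fun σ => {t | (fun k => t (positionEquiv σ k)) ∈ gapSet ε n 0} with hD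
  have hDm : ∀ σ, MeasurableSet (D σ) := fun σ =>
    (measurable_pi_lambda _ fun k => measurable_pi_apply _) (measurableSet_gapSet ε n 0)
  have hmem : ∀ σ z, z ∈ η ⁻¹' D σ ↔
      ∀ k : Fin n, defaultTime α x z (σ k.castSucc) + ε ≤ defaultTime α x z (σ k.succ) := by
    intro σ z
    have h1 := mem_gapSet_iff hε n 0 fun k => η z (positionEquiv σ k)
    simp only [positionEquiv_last, positionEquiv_castSucc] at h1
    refine h1.trans ?_
    rw [and_iff_right (le_min (IsAdmissible.eventTime_nonneg _ _ _)
      (IsAdmissible.eventTime_nonneg _ _ _))]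
    simp only [defaultTime, min_comm (eventTime (α 0) x (z 0)), hη]
  have hset : {z | ∀ i j : Fin (n + 1), i ≠ j → ε ≤ |defaultTime α x z i - defaultTime α x z j|}
      = ⋃ σ, η ⁻¹' D σ := by
    ext z
    rw [mem_iUnion, mem_ofPred_eq, separated_iff_exists_perm hε]
    exact exists_congr fun σ => (hmem σ z).symm
  have hdisj : Pairwise (Function.onFun Disjoint fun σ => η ⁻¹' D σ) := fun σ σ' hσ =>
    Set.disjoint_left.2 fun z hz hz' =>
      hσ (perm_unique_of_gaps hε ((hmem σ z).1 hz) ((hmem σ' z).1 hz'))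
  have hterm : ∀ σ, 0 ≤ orderTerm hn ε α x σ ∧
      Measure.pi (fun _ : Fin (n + 2) => expMeasure 1) (η ⁻¹' D σ)
        = ENNReal.ofReal (orderTerm hn ε α x σ) := by
    intro σ
    rw [← Measure.map_apply hηm (hDm σ), hmap, pi_reindex ν _ (measurableSet_gapSet ε n 0)]
    refine pi_gapSet hε
      (fun s => Real.exp (-cumIntensity (α (σ (Fin.last n)).succ) x s - cumIntensity (α 0) x s))
      n (fun k => ν (positionEquiv σ k))
      (fun k => defaultDensity (α (σ k.castSucc).succ) x)
      (fun k => (h _).measurable_defaultDensity) (fun k s => ((h _).defaultDensity_pos s).le)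
      (fun k => ?_) (fun s => (Real.exp_pos _).le) (fun s hs => ?_) le_rfl
    · rw [positionEquiv_castSucc]
      exact (h _).map_eventTime
    · rw [positionEquiv_castSucc, positionEquiv_last, hν]
      simp only
      rw [(h _).map_eventTime_Ici hs, (h _).map_eventTime_Ici hs,
        ← ENNReal.ofReal_mul (Real.exp_pos _).le, ← Real.exp_add, sub_eq_add_neg]
  refine ⟨Finset.sum_nonneg fun σ _ => (hterm σ).1, ?_⟩
  rw [hset, measure_iUnion hdisj fun σ => hηm (hDm σ), tsum_fintype,
    ENNReal.ofReal_sum_of_nonneg fun σ _ => (hterm σ).1]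
  exact Finset.sum_congr rfl fun σ _ => (hterm σ).2

/-! ### Default times as measurable functions of the path -/

/-- First passage time over `z` of a function known at the non-negative rational times `q⁺`. -/
noncomputable def rationalPassage (A : ℚ → ℝ) (z : ℝ) : ℝ :=
  (⨅ q : ℚ, if z ≤ A q then ((q : ℝ).toNNReal : ℝ≥0∞) else ⊤).toReal

lemma measurable_rationalPassage : Measurable fun p : (ℚ → ℝ) × ℝ => rationalPassage p.1 p.2 :=
  (Measurable.iInf fun q => Measurable.ite
    (measurableSet_le measurable_snd ((measurable_pi_apply q).comp measurable_fst))
    measurable_const measurable_const).ennreal_toReal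

lemma IsAdmissible.rationalPassage_eq {a : E → ℝ} {x : ℝ≥0 → E} (h : IsAdmissible a x) (z : ℝ) :
    rationalPassage (fun q => cumIntensity a x (q : ℝ).toNNReal) z = eventTime a x z := by
  have h0 := eventTime_nonneg a x z
  have key : (⨅ q : ℚ, if z ≤ cumIntensity a x (q : ℝ).toNNReal
      then ((q : ℝ).toNNReal : ℝ≥0∞) else ⊤) = ENNReal.ofReal (eventTime a x z) := by
    refine le_antisymm (not_lt.1 fun hlt => ?_) (le_iInf fun q => ?_)
    -- A rational strictly between the event time and the infimum would already have passed the
    -- level `z`.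
    · obtain ⟨q, -, hq, hq'⟩ := ENNReal.lt_iff_exists_rat_btwn.1 hlt
      have h1 : z ≤ cumIntensity a x (q : ℝ).toNNReal := by
        rw [← h.eventTime_le_iff NNReal.zero_le_coe]
        exact (Real.toNNReal_le_iff_le_coe).1 (ENNReal.coe_lt_coe.1 hq).le
      have h2 := iInf_le (fun q : ℚ => if z ≤ cumIntensity a x (q : ℝ).toNNReal
        then ((q : ℝ).toNNReal : ℝ≥0∞) else ⊤) q
      simp only [if_pos h1] at h2
      exact absurd hq' (not_lt.2 h2)
    · split_ifs with hz
      · rw [← h.eventTime_le_iff NNReal.zero_le_coe] at hz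
        exact ENNReal.coe_le_coe.2 (Real.toNNReal_le_iff_le_coe.2 hz)
      · exact le_top
  rw [rationalPassage, key, ENNReal.toReal_ofReal h0]

/-- The cumulative intensity as a limit of Riemann sums, hence a measurable function of the path. -/
noncomputable def riemannIntensity (a : E → ℝ) (x : ℝ≥0 → E) (s : ℝ) : ℝ :=
  limsup (fun n => ∫ r in (0 : ℝ)..s, a (x (rightGrid n r.toNNReal))) atTop

lemma measurable_riemannIntensity [MeasurableSpace E] {a : E → ℝ} (ha : Measurable a) {s : ℝ}
    (hs : 0 ≤ s) : Measurable fun x : ℝ≥0 → E => riemannIntensity a x s := by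
  refine Measurable.limsup fun n => ?_
  -- For fixed `n` the path is evaluated only at countably many grid points, which makes evaluation
  -- jointly measurable in path and time.
  have h1 : Measurable fun p : (ℝ≥0 → E) × ℕ => a (p.1 ((p.2 + 1) / (n + 1))) :=
    measurable_from_prod_countable_left fun k => ha.comp (measurable_pi_apply ((k + 1) / (n + 1) : ℝ≥0))
  have h2 : Measurable fun r : ℝ => ⌊((n : ℝ≥0) + 1) * r.toNNReal⌋₊ :=
    Nat.measurable_floor.comp (measurable_real_toNNReal.const_mul _)
  have h3 : Measurable (Function.uncurry fun (x : ℝ≥0 → E) (r : ℝ) =>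
      a (x (rightGrid n r.toNNReal))) :=
    h1.comp (measurable_fst.prodMk (h2.comp measurable_snd))
  simp only [intervalIntegral.integral_of_le hs]
  exact h3.stronglyMeasurable.integral_prod_right.measurable

lemma IsAdmissible.riemannIntensity_eq {a : E → ℝ} {x : ℝ≥0 → E} (h : IsAdmissible a x) (s : ℝ) :
    riemannIntensity a x s = cumIntensity a x s := by
  refine Tendsto.limsup_eq ?_
  -- The extra `1` covers the grid points, which overshoot by at most `1 / (n + 1)`.
  obtain ⟨M, hM⟩ := h.cadlag.exists_bound ((max 0 s).toNNReal + 1)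
  refine intervalIntegral.tendsto_integral_filter_of_dominated_convergence (fun _ => M)
    (Eventually.of_forall fun n => ?_) (Eventually.of_forall fun n => Eventually.of_forall
      fun r hr => ?_) intervalIntegrable_const (Eventually.of_forall fun r _ => ?_)
  · exact ((measurable_comp_rightGrid (a ∘ x) n).comp
      measurable_real_toNNReal).aestronglyMeasurable
  · have h1 : r.toNNReal ≤ (max 0 s).toNNReal := Real.toNNReal_le_toNNReal hr.2
    have h2 : 1 / ((n : ℝ≥0) + 1) ≤ 1 := by
      rw [div_le_iff₀ (by positivity), one_mul]
      exact le_add_of_nonneg_left zero_le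
    exact hM _ ((rightGrid_le n _).trans (add_le_add h1 h2))
  · exact ((h.cadlag r.toNNReal).1.tendsto).comp (tendsto_rightGrid r.toNNReal)

/-- The cumulative intensities at rational times, as a function of the path. -/
noncomputable def pathIntensities {ι : Type*} (α : ι → E → ℝ) (x : ℝ≥0 → E) : ι → ℚ → ℝ :=
  fun k q => riemannIntensity (α k) x (q : ℝ).toNNReal

lemma measurable_pathIntensities [MeasurableSpace E] {ι : Type*} {α : ι → E → ℝ}
    (hα : ∀ k, Measurable (α k)) : Measurable (pathIntensities α) := by
  rw [measurable_pi_iff]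
  intro k
  rw [measurable_pi_iff]
  intro q
  exact measurable_riemannIntensity (s := (q : ℝ).toNNReal) (hα k) NNReal.zero_le_coe

/-- The default time as a function of cumulative intensities at rational times and thresholds. -/
noncomputable def rationalDefaultTime {K : ℕ} (A : Fin (K + 1) → ℚ → ℝ) (z : Fin (K + 1) → ℝ)
    (i : Fin K) : ℝ :=
  min (rationalPassage (A 0) (z 0)) (rationalPassage (A i.succ) (z i.succ))

lemma measurable_rationalDefaultTime {K : ℕ} (i : Fin K) :
    Measurable fun p : (Fin (K + 1) → ℝ) × (Fin (K + 1) → ℚ → ℝ) =>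
      rationalDefaultTime p.2 p.1 i := by
  have h : ∀ k, Measurable fun p : (Fin (K + 1) → ℝ) × (Fin (K + 1) → ℚ → ℝ) =>
      rationalPassage (p.2 k) (p.1 k) := by
    intro k
    have h1 : Measurable fun p : (Fin (K + 1) → ℝ) × (Fin (K + 1) → ℚ → ℝ) => (p.2 k, p.1 k) := by
      fun_prop
    exact measurable_rationalPassage.comp h1
  exact (h 0).min (h i.succ)

lemma rationalDefaultTime_eq {K : ℕ} {α : Fin (K + 1) → E → ℝ} {x : ℝ≥0 → E}
    (h : ∀ i, IsAdmissible (α i) x) (z : Fin (K + 1) → ℝ) (i : Fin K) :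
    rationalDefaultTime (pathIntensities α x) z i
      = defaultTime α x z i := by
  have hk : ∀ k, pathIntensities α x k = fun q : ℚ => cumIntensity (α k) x (q : ℝ).toNNReal :=
    fun k => funext fun q => (h k).riemannIntensity_eq _
  simp only [rationalDefaultTime, hk, (h _).rationalPassage_eq, defaultTime]

/-- Thresholds and cumulative intensities for which all default times are `ε`-separated. -/
def separatedSet (K : ℕ) (ε : ℝ) : Set ((Fin (K + 1) → ℝ) × (Fin (K + 1) → ℚ → ℝ)) :=
  {p | ∀ i j : Fin K, i ≠ j →
    ε ≤ |rationalDefaultTime p.2 p.1 i - rationalDefaultTime p.2 p.1 j|}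

lemma measurableSet_separatedSet (K : ℕ) (ε : ℝ) : MeasurableSet (separatedSet K ε) := by
  simp only [separatedSet, ofPred_forall]
  refine MeasurableSet.iInter fun i => MeasurableSet.iInter fun j => MeasurableSet.iInter
    fun _ => measurableSet_le measurable_const ?_
  exact ((measurable_rationalDefaultTime i).sub (measurable_rationalDefaultTime j)).abs

lemma mem_separatedSet_iff {K : ℕ} {ε : ℝ} {α : Fin (K + 1) → E → ℝ} {x : ℝ≥0 → E}
    (h : ∀ i, IsAdmissible (α i) x) (z : Fin (K + 1) → ℝ) :
    (z, pathIntensities α x) ∈ separatedSet K ε ↔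
      ∀ i j : Fin K, i ≠ j → ε ≤ |defaultTime α x z i - defaultTime α x z j| := by
  simp only [separatedSet, mem_ofPred_eq, rationalDefaultTime_eq h]

end

end MarketFailure

/-! ### Averaging over the path -/

theorem mainTheorem1
    {Ω : Type*} [MeasurableSpace Ω] (μ : Measure Ω) [IsProbabilityMeasure μ]
    (d K : ℕ) (hK : 2 ≤ K)
    -- the state variable process
    (X : ℝ≥0 → Ω → EuclideanSpace ℝ (Fin d))
    (hX : ∀ t, Measurable (X t))
    (hXcadlag : ∀ᵐ ω ∂μ, MarketFailure.IsCadlag (fun t => X t ω))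
    -- the unit exponential thresholds, independent of each other and of the process
    (Z : Fin (K + 1) → Ω → ℝ)
    (hZ : ∀ i, HasLaw (Z i) (expMeasure 1) μ)
    (hZindep : iIndepFun Z μ)
    (hZX : IndepFun (fun ω i => Z i ω) (fun ω t => X t ω) μ)
    -- the intensities
    (α : Fin (K + 1) → EuclideanSpace ℝ (Fin d) → ℝ)
    (hαcont : ∀ i, Continuous (α i))
    (hαpos : ∀ i x, 0 < α i x)
    (hA : ∀ i, ∀ᵐ ω ∂μ,
      Tendsto (fun s => MarketFailure.cumIntensity (α i) (fun t => X t ω) s) atTop atTop)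
    (ε : ℝ) (hε : 0 < ε) :
    NullMeasurableSet
      {ω | ∃ i j : Fin K, i ≠ j ∧
        |MarketFailure.defaultTime α (fun t => X t ω) (fun k => Z k ω) i
          - MarketFailure.defaultTime α (fun t => X t ω) (fun k => Z k ω) j| < ε} μ ∧
    Integrable
      (fun ω => ∑ σ : Equiv.Perm (Fin K),
        MarketFailure.orderTerm hK ε α (fun t => X t ω) σ) μ ∧
    μ.real
      {ω | ∃ i j : Fin K, i ≠ j ∧
        |MarketFailure.defaultTime α (fun t => X t ω) (fun k => Z k ω) i
          - MarketFailure.defaultTime α (fun t => X t ω) (fun k => Z k ω) j| < ε}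
      = 1 - ∫ ω, ∑ σ : Equiv.Perm (Fin K),
          MarketFailure.orderTerm hK ε α (fun t => X t ω) σ ∂μ := by
  obtain ⟨n, rfl⟩ : ∃ n, K = n + 1 := ⟨K - 1, by omega⟩
  have hexp := isProbabilityMeasure_expMeasure (r := 1) one_pos
  have hgood : ∀ᵐ ω ∂μ, ∀ i, MarketFailure.IsAdmissible (α i) (fun t => X t ω) := by
    filter_upwards [hXcadlag, ae_all_iff.2 hA] with ω h1 h2 i
    exact ⟨fun t => hαpos i _, h1.continuous_comp (hαcont i), h2 i⟩
  set bad : Set Ω := {ω | ∃ i j : Fin (n + 1), i ≠ j ∧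
    |MarketFailure.defaultTime α (fun t => X t ω) (fun k => Z k ω) i
      - MarketFailure.defaultTime α (fun t => X t ω) (fun k => Z k ω) j| < ε} with hbad
  set S : Ω → ℝ := fun ω => ∑ σ, MarketFailure.orderTerm hK ε α (fun t => X t ω) σ with hS
  set B : (ℝ≥0 → EuclideanSpace ℝ (Fin d)) → Fin (n + 2) → ℚ → ℝ :=
    MarketFailure.pathIntensities α with hB
  have hBm : Measurable B :=
    MarketFailure.measurable_pathIntensities fun k => (hαcont k).measurable
  have hXm : Measurable fun ω t => X t ω := measurable_pi_lambda _ hX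
  have hBX : Measurable fun ω => B fun t => X t ω := hBm.comp hXm
  have hZm : AEMeasurable (fun ω i => Z i ω) μ :=
    aemeasurable_pi_lambda _ fun i => (hZ i).aemeasurable
  set sep := MarketFailure.separatedSet (n + 1) ε with hsep
  have hsepm : MeasurableSet sep := MarketFailure.measurableSet_separatedSet (n + 1) ε
  -- Both independence hypotheses enter here: thresholds among themselves, and thresholds against
  -- the process.
  have hlaw : μ.map (fun ω => ((fun i => Z i ω), B fun t => X t ω))
      = (Measure.pi fun _ => expMeasure 1).prod (μ.map fun ω => B fun t => X t ω) := by
    rw [(indepFun_iff_map_prod_eq_prod_map_map hZm hBX.aemeasurable).1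
      (hZX.comp measurable_id hBm),
      (iIndepFun_iff_map_fun_eq_pi_map fun i => (hZ i).aemeasurable).1 hZindep]
    simp only [(hZ _).map_eq]
  set good : Set Ω := (fun ω => ((fun i => Z i ω), B fun t => X t ω)) ⁻¹' sep
  have hgoodm : NullMeasurableSet good μ :=
    (hZm.prodMk hBX.aemeasurable).nullMeasurable hsepm
  have hcompl : bad =ᵐ[μ] (goodᶜ : Set Ω) := by
    rw [eventuallyEq_set]
    filter_upwards [hgood] with ω hω
    rw [mem_compl_iff, mem_preimage, hB, MarketFailure.mem_separatedSet_iff hω]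
    simp only [hbad, mem_ofPred_eq]
    push Not
    rfl
  -- `ρ` is the separation probability given the path. It is measurable everywhere, whereas `S` is
  -- identified with it only almost surely.
  set ρ : Ω → ℝ≥0∞ := fun ω =>
    Measure.pi (fun _ : Fin (n + 2) => expMeasure 1) {z | (z, B fun t => X t ω) ∈ sep} with hρ
  have hρm : Measurable ρ := (measurable_measure_prodMk_right hsepm).comp hBX
  have hρS : ∀ᵐ ω ∂μ, 0 ≤ S ω ∧ ρ ω = ENNReal.ofReal (S ω) := by
    filter_upwards [hgood] with ω hω
    have h := MarketFailure.pi_exp_separated hK hε α (fun t => X t ω) hω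
    refine ⟨h.1, h.2 ▸ ?_⟩
    simp only [hρ, hsep, hB, MarketFailure.mem_separatedSet_iff hω]
  have hρS' : (fun ω => (ρ ω).toReal) =ᵐ[μ] S := by
    filter_upwards [hρS] with ω hω
    rw [hω.2, ENNReal.toReal_ofReal hω.1]
  have hint : Integrable S μ := by
    refine Integrable.congr (Integrable.of_bound hρm.ennreal_toReal.aestronglyMeasurable 1
      (Eventually.of_forall fun ω => ?_)) hρS'
    rw [Real.norm_of_nonneg ENNReal.toReal_nonneg]
    exact ENNReal.toReal_le_of_le_ofReal zero_le_one (by simpa using prob_le_one)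
  have hprob : μ good = ENNReal.ofReal (∫ ω, S ω ∂μ) := by
    rw [ofReal_integral_eq_lintegral_ofReal hint (hρS.mono fun ω h => h.1),
      ← lintegral_congr_ae (hρS.mono fun ω h => h.2),
      ← Measure.map_apply_of_aemeasurable (hZm.prodMk hBX.aemeasurable) hsepm, hlaw,
      Measure.prod_apply_symm hsepm, lintegral_map (measurable_measure_prodMk_right hsepm) hBX]
    rfl
  refine ⟨hgoodm.compl.congr hcompl.symm, hint, ?_⟩
  rw [measureReal_congr hcompl, probReal_compl_eq_one_sub₀ hgoodm, measureReal_def, hprob,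
    ENNReal.toReal_ofReal (integral_nonneg_of_ae (hρS.mono fun ω h => h.1))]
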